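/- Let $d\ge 1$ and let $\Phi$ be a stationary point process on $\mathbb{R}^d$, i.e. a translation-invariant (in law) random measure with values in $\{0,1,2,\dots\}$ on bounded Borel sets, with unit intensity $\mathbb{E}\,\Phi([0,1]^d)=1$. Assume that $\Phi$ is $\alpha$-weakly sub-Poisson, i.e. $$\mathbb{E}\prod_{i=1}^m\Phi(B_i)\le\prod_{i=1}^m\mathbb{E}\,\Phi(B_i)$$ for all $m\ge1$ and all mutually disjoint bounded Borel sets $B_1,\dots,B_m\subset\mathbb{R}^d$. For $n\ge 1$ let $W_n=[-n^{1/d}/2,\,n^{1/d}/2]^d$ and $r_n>0$, and let $G_n$ be the random geometric graph whose vertices are the distinct points (atoms) of $\Phi$ lying in $W_n$, two distinct vertices $x,y$ being adjacent if and only if $|x-y|\le r_n$ (Euclidean distance). Let $\mathcal{C}_n$, $\Delta_n$ and $\mathcal{X}_n$ denote the clique number (size of the largest clique), the maximal vertex degree and the chromatic number of $G_n$, respectively (all equal to $0$ if $G_n$ has no vertices). Let $k\ge1$ be an integer. If $n\,r_n^{d(k-1)}\to0$ as $n\to\infty$, then $$\lim_{n\to\infty}\mathbb{P}(\mathcal{C}_n<k)=\lim_{n\to\infty}\mathbb{P}(\Delta_n<k-1)=\lim_{n\to\infty}\mathbb{P}(\mathcal{X}_n<k)=1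 .$$ -/

import Mathlib

open MeasureTheory ProbabilityTheory Filter Topology
open scoped ENNReal

noncomputable section

namespace SubPoisson

/-- The Euclidean space `ℝ^d`. -/
abbrev Space (d : ℕ) : Type := EuclideanSpace ℝ (Fin d)

/-- A point process on `ℝ^d`: a random measure (for the `σ`-algebra on measures generated by the
evaluations `μ ↦ μ B`, `B` Borel) that takes finite nonnegative integer values on all bounded Borel
sets. Simplicity is not required. -/
structure IsPointProcess {d : ℕ} {Ω : Type*} [MeasurableSpace Ω]
    (Φ : Ω → Measure (Space d)) : Prop where
  measurable : Measurable Φ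
  counting : ∀ (ω : Ω) (B : Set (Space d)), MeasurableSet B → Bornology.IsBounded B →
    ∃ m : ℕ, Φ ω B = m

/-- Stationarity: for every `t`, the translate of `Φ` by `t` has the same law as `Φ`. -/
def IsStationary {d : ℕ} {Ω : Type*} [MeasurableSpace Ω]
    (Φ : Ω → Measure (Space d)) (P : Measure Ω) : Prop :=
  ∀ t : Space d, IdentDistrib (fun ω => (Φ ω).map (fun x => x + t)) Φ P P

/-- The unit cube `[0,1]^d`. -/
def unitCube (d : ℕ) : Set (Space d) :=
  {x | ∀ i, x i ∈ Set.Icc (0 : ℝ) 1}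

/-- The intensity `E Φ([0,1]^d)` (of a stationary point process). -/
def intensity {d : ℕ} {Ω : Type*} [MeasurableSpace Ω]
    (Φ : Ω → Measure (Space d)) (P : Measure Ω) : ℝ≥0∞ :=
  ∫⁻ ω, Φ ω (unitCube d) ∂P

/-- `α`-weakly sub-Poisson: `E ∏ Φ(B_i) ≤ ∏ E Φ(B_i)` for all finite families of mutually disjoint
bounded Borel sets `B_i`. -/
def IsAlphaWeaklySubPoisson {d : ℕ} {Ω : Type*} [MeasurableSpace Ω]
    (Φ : Ω → Measure (Space d)) (P : Measure Ω) : Prop :=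
  ∀ (m : ℕ), 1 ≤ m → ∀ B : Fin m → Set (Space d),
    (∀ i, MeasurableSet (B i)) → (∀ i, Bornology.IsBounded (B i)) →
    Pairwise (fun i j => Disjoint (B i) (B j)) →
      ∫⁻ ω, ∏ i, Φ ω (B i) ∂P ≤ ∏ i, ∫⁻ ω, Φ ω (B i) ∂P

/-- The observation window `W_n = [-n^{1/d}/2, n^{1/d}/2]^d`. -/
def window (d n : ℕ) : Set (Space d) :=
  {x | ∀ i, x i ∈ Set.Icc (-((n : ℝ) ^ (1 / (d : ℝ)) / 2)) ((n : ℝ) ^ (1 / (d : ℝ)) / 2)}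

/-- The set of (distinct) points of a counting measure: its atoms. -/
def points {d : ℕ} (μ : Measure (Space d)) : Set (Space d) :=
  {x | μ {x} ≠ 0}

/-- The random geometric graph on a point set `S`: distinct points are joined by an edge
if and only if their Euclidean distance is at most `r`. -/
def geometricGraph {d : ℕ} (S : Set (Space d)) (r : ℝ) : SimpleGraph S where
  Adj x y := x ≠ y ∧ dist (x : Space d) (y : Space d) ≤ r
  symm := ⟨fun x y h => ⟨h.1.symm, by rw [dist_comm]; exact h.2⟩⟩
  loopless := ⟨fun _ h => h.1 rfl⟩

/-- The random geometric graph with radius `r` on the points of `Φ ∩ W_n`. -/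
abbrev windowGraph {d : ℕ} (μ : Measure (Space d)) (n : ℕ) (r : ℝ) :
    SimpleGraph (points μ ∩ window d n : Set (Space d)) :=
  geometricGraph (points μ ∩ window d n) r

/-- The maximal vertex degree of a graph, as an extended natural number
(`0` for the graph without vertices). -/
def maxDeg {V : Type*} (G : SimpleGraph V) : ℕ∞ :=
  ⨆ v : V, (G.neighborSet v).encard

/-- `P(A_n) → 1`. The second clause follows from the first when the `A_n` are measurable; it is
included because `P` of a set means its outer measure if measurability is not known, so that the two
clauses together give the limit `1` for the inner as well as for the outer probability of `A_n`. -/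
def WithHighProbability {Ω : Type*} [MeasurableSpace Ω] (P : Measure Ω) (A : ℕ → Set Ω) : Prop :=
  Tendsto (fun n => P (A n)) atTop (𝓝 1) ∧ Tendsto (fun n => P (A n)ᶜ) atTop (𝓝 0)

end SubPoisson

end

/-! If every vertex has degree below `k - 1`, then cliques have at most `k - 1` vertices and greedy
colouring needs at most `k - 1` colours. So all three claims reduce to one event: no closed ball of
radius `r_n` centred in `W_n` contains `k` distinct atoms.

The window is covered by `O(n / r_n^d)` balls of radius `d r_n`; enlarged to radius `(d + 1) r_n`,
they catch every such cluster. By stationarity and uniqueness of Haar measure each enlarged ball has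
mean count `O(r_n^d)`. The probabilistic core, `measure_hasDistinctAtoms_le`, bounds the probability
of `k` distinct atoms in `Q` by `(E Φ(Q))^k`: atoms are separated by a fine partition, and
sub-Poissonianity is applied to tuples of distinct cells. A union bound gives `O(n r_n^{d(k-1)})`,
which tends to `0`. -/

/-! ### Separating points by refining partitions -/

namespace MeasurableSpace

variable {α : Type*} [MeasurableSpace α] [CountablyGenerated α]

theorem countablePartitionSet_antitone (a : α) :
    Antitone fun n => countablePartitionSet n a := by
  classical
  refine antitone_nat_of_succ_le fun n => ?_
  unfold countablePartitionSet
  rw [memPartitionSet_succ]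
  split_ifs
  · exact Set.inter_subset_left
  · exact Set.sdiff_subset

/-- The cells generate a σ-algebra that separates points, so some level tells `x` from `y`; nesting
of the cells keeps them apart at all later levels. -/
theorem eventually_countablePartitionSet_ne [MeasurableSingletonClass α] {x y : α} (h : x ≠ y) :
    ∀ᶠ n in atTop, countablePartitionSet n x ≠ countablePartitionSet n y := by
  obtain ⟨m, s, hs, hxy⟩ : ∃ m, ∃ s ∈ countablePartition α m, ¬ (x ∈ s ↔ y ∈ s) := by
    by_contra! hcon
    refine h (separatesPoints_iff.1 inferInstance x y ?_)
    have key := (forall_generateFrom_mem_iff_mem_iff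
      (S := ⋃ n, countablePartition α n) (x := x) (y := y)).2 (by
        intro s hs
        obtain ⟨n, hn⟩ := Set.mem_iUnion.1 hs
        exact hcon n s hn)
    rwa [generateFrom_iUnion_countablePartition] at key
  filter_upwards [eventually_ge_atTop m] with n hn heq
  have hx : x ∈ countablePartitionSet m y :=
    by
    refine countablePartitionSet_antitone y hn ?_
    have h1 := mem_countablePartitionSet n x
    rwa [heq] at h1
  have hxy' : countablePartitionSet m x = countablePartitionSet m y :=
    countablePartitionSet_of_mem (countablePartitionSet_mem m y) hx
  apply hxy
  rw [← countablePartitionSet_eq_iff x hs, ← countablePartitionSet_eq_iff y hs, hxy']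

end MeasurableSpace

/-! ### Consequences of a degree bound -/

namespace SimpleGraph

/-- Greedy colouring: if every vertex of a finite graph has fewer than `m` neighbours, then `m`
colours suffice. -/
theorem colorable_of_forall_encard_neighborSet_lt {V : Type*} [Finite V] (G : SimpleGraph V)
    {m : ℕ} (h : ∀ v, (G.neighborSet v).encard < m) : G.Colorable m := by
  classical
  have := Fintype.ofFinite V
  have free (c : V → Fin m) (v : V) : ∃ a, ∀ y, G.Adj v y → c y ≠ a := by
    by_contra! hcon
    have h1 : (Set.univ : Set (Fin m)) ⊆ c '' G.neighborSet v := fun a _ => by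
      obtain ⟨y, hy, rfl⟩ := hcon a
      exact ⟨y, hy, rfl⟩
    have h2 := (Set.encard_le_encard h1).trans (Set.encard_image_le _ _)
    rw [Set.encard_univ, ENat.card_eq_coe_fintype_card, Fintype.card_fin] at h2
    exact absurd (h v) (not_lt.2 h2)
  -- The colouring is total but proper only on `s`, so the inductive step merely recolours the
  -- inserted vertex.
  have key (s : Finset V) : ∃ c : V → Fin m, ∀ x ∈ s, ∀ y ∈ s, G.Adj x y → c x ≠ c y := by
    induction s using Finset.induction_on with
    | empty =>
      have hpos (v : V) : 0 < m := by
        rcases Nat.eq_zero_or_pos m with rfl | hm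
        · exact absurd (h v) (by simp)
        · exact hm
      exact ⟨fun v => ⟨0, hpos v⟩, by simp⟩
    | insert v s hv ih =>
      obtain ⟨c, hc⟩ := ih
      obtain ⟨a, ha⟩ := free c v
      refine ⟨Function.update c v a, fun x hx y hy hxy => ?_⟩
      rcases eq_or_ne x v with rfl | hxv
      · rw [Function.update_self, Function.update_of_ne hxy.ne']
        exact (ha y hxy).symm
      · rcases eq_or_ne y v with rfl | hyv
        · rw [Function.update_self, Function.update_of_ne hxv]
          exact ha x hxy.symm
        · rw [Function.update_of_ne hxv, Function.update_of_ne hyv]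
          exact hc x ((Finset.mem_insert.1 hx).resolve_left hxv) y
            ((Finset.mem_insert.1 hy).resolve_left hyv) hxy
  obtain ⟨c, hc⟩ := key Finset.univ
  exact ⟨Coloring.mk c fun {x y} hxy => hc x (Finset.mem_univ _) y (Finset.mem_univ _) hxy⟩

/-- Each vertex of a clique is adjacent to all the others. -/
theorem cliqueNum_le_of_forall_encard_neighborSet_lt {V : Type*} (G : SimpleGraph V)
    {m : ℕ} (h : ∀ v, (G.neighborSet v).encard < m) : G.cliqueNum ≤ m := by
  classical
  refine csSup_le ⟨0, ∅, by simp [isNClique_iff]⟩ ?_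
  rintro n ⟨s, hs⟩
  rw [isNClique_iff] at hs
  obtain ⟨hs, rfl⟩ := hs
  rcases s.eq_empty_or_nonempty with rfl | ⟨v, hv⟩
  · simp
  have hsub : ((s.erase v : Finset V) : Set V) ⊆ G.neighborSet v := fun w hw => by
    rw [Finset.mem_coe, Finset.mem_erase] at hw
    exact hs hv hw.2 hw.1.symm
  have h1 := (Set.encard_le_encard hsub).trans_lt (h v)
  rw [Set.encard_coe_eq_coe_finsetCard, Nat.cast_lt, Finset.card_erase_of_mem hv] at h1
  omega

end SimpleGraph

/-! ### Atoms of counting measures and the moment bound -/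

namespace SubPoisson

/-- Degrees are at most `m - 1`, so the bound stays strict under the supremum; `1 ≤ m` covers the
graph without vertices. -/
theorem maxDeg_lt {V : Type*} {G : SimpleGraph V} {m : ℕ} (hm : 1 ≤ m)
    (h : ∀ v, (G.neighborSet v).encard < m) : maxDeg G < m := by
  obtain ⟨m, rfl⟩ := Nat.exists_eq_add_of_le' hm
  refine lt_of_le_of_lt (b := (m : ℕ∞)) (iSup_le fun v => ?_) (by exact_mod_cast m.lt_succ_self)
  have := h v
  push_cast at this
  exact Order.le_of_lt_add_one this

/-- Every atom has mass at least `1`, so the finite mass of `W` bounds their number. Greedy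
colouring needs this finiteness. -/
theorem finite_points_inter {d : ℕ} {μ : Measure (Space d)} {W : Set (Space d)}
    (hcount : ∀ B, MeasurableSet B → Bornology.IsBounded B → ∃ m : ℕ, μ B = m)
    (hWm : MeasurableSet W) (hW : Bornology.IsBounded W) : (points μ ∩ W).Finite := by
  by_contra hinf
  obtain ⟨m, hm⟩ := hcount W hWm hW
  obtain ⟨t, ht, hcard⟩ := Set.Infinite.exists_subset_card_eq hinf (m + 1)
  have hone (x : Space d) (hx : x ∈ t) : 1 ≤ μ {x} := by
    obtain ⟨j, hj⟩ := hcount {x} (measurableSet_singleton x) Bornology.isBounded_singleton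
    have h0 := (ht hx).1
    rw [points, Set.mem_ofPred_eq, hj] at h0
    rw [hj]
    exact_mod_cast Nat.one_le_iff_ne_zero.2 (by exact_mod_cast h0)
  have h1 : ((m + 1 : ℕ) : ℝ≥0∞) ≤ m := by
    calc ((m + 1 : ℕ) : ℝ≥0∞) = ∑ x ∈ t, 1 := by simp [hcard]
      _ ≤ ∑ x ∈ t, μ {x} := Finset.sum_le_sum hone
      _ = μ t := sum_measure_singleton
      _ ≤ μ W := measure_mono fun x hx => (ht hx).2
      _ = m := hm
  have h2 : m + 1 ≤ m := by exact_mod_cast h1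
  omega

/-- The event that a counting measure has at least `k` distinct atoms in `Q`. -/
def HasDistinctAtoms {d : ℕ} (μ : Measure (Space d)) (k : ℕ) (Q : Set (Space d)) : Prop :=
  ∃ p : Fin k → Space d, Function.Injective p ∧ ∀ i, p i ∈ points μ ∩ Q

/-- If a vertex of the geometric graph has at least `m` neighbours, then the closed ball around it
contains at least `m + 1` points. -/
theorem hasDistinctAtoms_of_le_encard_neighborSet {d : ℕ} {μ : Measure (Space d)}
    {W : Set (Space d)} {r : ℝ} (hr : 0 ≤ r) {m : ℕ}
    {v : (points μ ∩ W : Set (Space d))}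
    (h : (m : ℕ∞) ≤ ((geometricGraph (points μ ∩ W) r).neighborSet v).encard) :
    HasDistinctAtoms μ (m + 1) (Metric.closedBall (v : Space d) r) := by
  classical
  obtain ⟨t, ht, hcard⟩ := Set.exists_subset_encard_eq h
  have htfin : t.Finite := Set.finite_of_encard_eq_coe hcard
  have hcard' : htfin.toFinset.card = m := by
    rw [htfin.encard_eq_coe_toFinset_card] at hcard
    exact_mod_cast hcard
  let e : Fin m ≃ htfin.toFinset := (htfin.toFinset.equivFinOfCardEq hcard').symm
  have hadj (i : Fin m) := ht (htfin.mem_toFinset.1 (e i).2)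
  refine ⟨Fin.cons v fun i => ((e i : (points μ ∩ W : Set (Space d))) : Space d), ?_, ?_⟩
  · rw [Fin.cons_injective_iff]
    refine ⟨?_, fun i j hij => e.injective (Subtype.ext (Subtype.ext hij))⟩
    rintro ⟨i, hi⟩
    exact (hadj i).1 (Subtype.ext hi.symm)
  · intro i
    refine Fin.cases ?_ (fun i => ?_) i
    · exact ⟨v.2.1, by simpa using hr⟩
    · refine ⟨((e i : (points μ ∩ W : Set (Space d)))).2.1, ?_⟩
      rw [Fin.cons_succ, Metric.mem_closedBall, dist_comm]
      exact (hadj i).2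

/-- For a fixed injective `f`, nonzero integer counts have product at least `1`, so Markov's
inequality and sub-Poissonianity bound the probability by a product of means. Adding the
non-injective tuples lets the sum of these products factor as a `k`-th power, and disjointness
bounds its base by `E Φ(Q)`. -/
theorem measure_exists_distinct_cells_le {d : ℕ} {Ω : Type*} [MeasurableSpace Ω]
    {P : Measure Ω} {Φ : Ω → Measure (Space d)} (hΦ : IsPointProcess Φ)
    (hsub : IsAlphaWeaklySubPoisson Φ P) {k : ℕ} (hk : 1 ≤ k)
    {Q : Set (Space d)} (hQm : MeasurableSet Q) (hQ : Bornology.IsBounded Q)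
    {ι : Type*} [Finite ι] {C : ι → Set (Space d)} (hC : ∀ i, MeasurableSet (C i))
    (hdisj : Pairwise fun i j => Disjoint (C i) (C j)) :
    P {ω | ∃ f : Fin k → ι, Function.Injective f ∧ ∀ i, Φ ω (C (f i) ∩ Q) ≠ 0} ≤
      (∫⁻ ω, Φ ω Q ∂P) ^ k := by
  classical
  have := Fintype.ofFinite ι
  have hmeas (f : Fin k → ι) (i : Fin k) : Measurable fun ω => Φ ω (C (f i) ∩ Q) :=
    (Measure.measurable_coe ((hC _).inter hQm)).comp hΦ.measurable
  have hmeas' (i : ι) : Measurable fun ω => Φ ω (C i ∩ Q) :=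
    (Measure.measurable_coe ((hC _).inter hQm)).comp hΦ.measurable
  have hone (f : Fin k → ι) (hf : Function.Injective f) :
      P {ω | ∀ i, Φ ω (C (f i) ∩ Q) ≠ 0} ≤ ∏ i, ∫⁻ ω, Φ ω (C (f i) ∩ Q) ∂P := by
    calc P {ω | ∀ i, Φ ω (C (f i) ∩ Q) ≠ 0}
        ≤ P {ω | 1 ≤ ∏ i, Φ ω (C (f i) ∩ Q)} := by
          refine measure_mono fun ω hω => ?_
          refine Finset.one_le_prod' (s := Finset.univ) (f := fun i => Φ ω (C (f i) ∩ Q)) fun i _ => ?_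
          obtain ⟨m, hm⟩ := hΦ.counting ω _ ((hC (f i)).inter hQm) (hQ.subset Set.inter_subset_right)
          have h0 := hω i
          rw [hm] at h0 ⊢
          exact_mod_cast Nat.one_le_iff_ne_zero.2 (by exact_mod_cast h0)
      _ ≤ ∫⁻ ω, ∏ i, Φ ω (C (f i) ∩ Q) ∂P := by
          have := mul_meas_ge_le_lintegral (μ := P)
            (Finset.measurable_prod Finset.univ fun i _ => hmeas f i) 1
          simpa using this
      _ ≤ ∏ i, ∫⁻ ω, Φ ω (C (f i) ∩ Q) ∂P := by
          refine hsub k hk _ (fun i => (hC _).inter hQm)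
            (fun i => hQ.subset Set.inter_subset_right) fun i j hij => ?_
          exact (hdisj (hf.ne hij)).mono Set.inter_subset_left Set.inter_subset_left
  have hsum : ∑ i, ∫⁻ ω, Φ ω (C i ∩ Q) ∂P ≤ ∫⁻ ω, Φ ω Q ∂P := by
    rw [← lintegral_finsetSum _ fun i _ => hmeas' i]
    refine lintegral_mono fun ω => ?_
    rw [← measure_biUnion_finset (fun i _ j _ hij =>
      (hdisj hij).mono Set.inter_subset_left Set.inter_subset_left)
      fun i _ => (hC i).inter hQm]
    exact measure_mono (Set.iUnion₂_subset fun i _ => Set.inter_subset_right)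
  calc P {ω | ∃ f : Fin k → ι, Function.Injective f ∧ ∀ i, Φ ω (C (f i) ∩ Q) ≠ 0}
      ≤ P (⋃ f ∈ (Finset.univ.filter fun f : Fin k → ι => Function.Injective f),
          {ω | ∀ i, Φ ω (C (f i) ∩ Q) ≠ 0}) := by
        refine measure_mono ?_
        rintro ω ⟨f, hf, hω⟩
        exact Set.mem_biUnion (by simpa using hf) hω
    _ ≤ ∑ f ∈ (Finset.univ.filter fun f : Fin k → ι => Function.Injective f),
          P {ω | ∀ i, Φ ω (C (f i) ∩ Q) ≠ 0} := measure_biUnion_finset_le _ _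
    _ ≤ ∑ f ∈ (Finset.univ.filter fun f : Fin k → ι => Function.Injective f),
          ∏ i, ∫⁻ ω, Φ ω (C (f i) ∩ Q) ∂P :=
        Finset.sum_le_sum fun f hf => hone f (by simpa using hf)
    _ ≤ ∑ f : Fin k → ι, ∏ i, ∫⁻ ω, Φ ω (C (f i) ∩ Q) ∂P :=
        Finset.sum_le_sum_of_subset (Finset.filter_subset _ _)
    _ = (∑ i, ∫⁻ ω, Φ ω (C i ∩ Q) ∂P) ^ k := (Fintype.sum_pow (fun i => ∫⁻ ω, Φ ω (C i ∩ Q) ∂P) k).symm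
    _ ≤ (∫⁻ ω, Φ ω Q ∂P) ^ k := by gcongr

/-- The probability that a weakly sub-Poisson process has `k` distinct atoms in `Q` is at most the
`k`-th power of the expected number of points in `Q`. -/
theorem measure_hasDistinctAtoms_le {d : ℕ} {Ω : Type*} [MeasurableSpace Ω]
    {P : Measure Ω} {Φ : Ω → Measure (Space d)} (hΦ : IsPointProcess Φ)
    (hsub : IsAlphaWeaklySubPoisson Φ P) {k : ℕ} (hk : 1 ≤ k)
    {Q : Set (Space d)} (hQm : MeasurableSet Q) (hQ : Bornology.IsBounded Q) :
    P {ω | HasDistinctAtoms (Φ ω) k Q} ≤ (∫⁻ ω, Φ ω Q ∂P) ^ k := by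
  let A (n : ℕ) : Set Ω := {ω | ∃ f : Fin k → MeasurableSpace.countablePartition (Space d) n,
    Function.Injective f ∧ ∀ i, Φ ω ((f i : Set (Space d)) ∩ Q) ≠ 0}
  have hA (n : ℕ) : P (A n) ≤ (∫⁻ ω, Φ ω Q ∂P) ^ k :=
    measure_exists_distinct_cells_le hΦ hsub hk hQm hQ
      (C := fun s : MeasurableSpace.countablePartition (Space d) n => (s : Set (Space d)))
      (fun s => MeasurableSpace.measurableSet_countablePartition n s.2)
      fun s t hst => MeasurableSpace.disjoint_countablePartition s.2 t.2
        fun h => hst (Subtype.ext h)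
  -- There are finitely many pairs of atoms, so one level `N` separates them all, as does every
  -- later level.
  have hsubset : {ω | HasDistinctAtoms (Φ ω) k Q} ⊆ ⋃ N, ⋂ n ≥ N, A n := by
    rintro ω ⟨p, hp, hpQ⟩
    have hsep : ∀ᶠ n in atTop, ∀ i j, i ≠ j →
        MeasurableSpace.countablePartitionSet n (p i) ≠
          MeasurableSpace.countablePartitionSet n (p j) := by
      simp only [eventually_all]
      exact fun i j hij => MeasurableSpace.eventually_countablePartitionSet_ne (hp.ne hij)
    obtain ⟨N, hN⟩ := eventually_atTop.1 hsep
    refine Set.mem_iUnion.2 ⟨N, Set.mem_iInter₂.2 fun n hn => ?_⟩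
    refine ⟨fun i => ⟨_, MeasurableSpace.countablePartitionSet_mem n (p i)⟩, ?_, fun i h0 => ?_⟩
    · intro i j hij
      by_contra hne
      exact hN n hn i j hne (Subtype.ext_iff.1 hij)
    · refine (hpQ i).1 (measure_mono_null ?_ h0)
      exact Set.singleton_subset_iff.2
        ⟨MeasurableSpace.mem_countablePartitionSet n (p i), (hpQ i).2⟩
  have hmono : Monotone fun N => ⋂ n ≥ N, A n := fun M N hMN =>
    Set.biInter_subset_biInter_left fun n (hn : N ≤ n) => hMN.trans hn
  refine (measure_mono hsubset).trans ?_
  -- Continuity from below along increasing sets requires no measurability of the events.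
  rw [hmono.measure_iUnion]
  exact iSup_le fun N => (measure_mono (Set.biInter_subset_of_mem (Set.mem_ofPred.2 le_rfl))).trans
    (hA N)

end SubPoisson

/-! ### The intensity measure of a stationary process -/

namespace SubPoisson

theorem interior_unitCube_nonempty (d : ℕ) : (interior (unitCube d)).Nonempty := by
  have hopen : IsOpen {x : Space d | ∀ i, x i ∈ Set.Ioo (0 : ℝ) 1} := by
    have : {x : Space d | ∀ i, x i ∈ Set.Ioo (0 : ℝ) 1} =
        ⋂ i, (fun x : Space d => x i) ⁻¹' Set.Ioo (0 : ℝ) 1 := by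
      ext x; simp
    rw [this]
    exact isOpen_iInter_of_finite fun i => isOpen_Ioo.preimage (by fun_prop)
  refine ⟨WithLp.toLp 2 fun _ => 1 / 2, interior_maximal ?_ hopen fun i => ?_⟩
  · exact fun x hx i => Set.Ioo_subset_Icc_self (hx i)
  · constructor <;> norm_num

/-- `P.bind Φ` is the intensity measure `B ↦ E Φ(B)`; its invariance makes it a multiple of Lebesgue
measure. -/
theorem isAddLeftInvariant_bind {d : ℕ} {Ω : Type*} [MeasurableSpace Ω]
    {P : Measure Ω} {Φ : Ω → Measure (Space d)} (hΦ : Measurable Φ)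
    (hstat : IsStationary Φ P) : (P.bind Φ).IsAddLeftInvariant := by
  refine ⟨fun t => Measure.ext fun s hs => ?_⟩
  have hadd : Measurable fun x : Space d => t + x := measurable_const_add t
  have hadd' : Measurable fun x : Space d => x + t := measurable_add_const t
  rw [Measure.map_apply hadd hs, Measure.bind_apply (hadd hs) hΦ.aemeasurable,
    Measure.bind_apply hs hΦ.aemeasurable]
  refine Eq.trans ?_ ((hstat t).comp (Measure.measurable_coe hs)).lintegral_eq
  refine lintegral_congr fun ω => ?_
  simp only [Function.comp_apply]
  rw [Measure.map_apply hadd' hs]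
  simp only [add_comm]

/-- The expected number of points of a stationary process of finite intensity in a ball is
proportional to the `d`-th power of the radius. -/
theorem exists_lintegral_closedBall_eq {d : ℕ} {Ω : Type*} [MeasurableSpace Ω]
    {P : Measure Ω} {Φ : Ω → Measure (Space d)} (hΦ : Measurable Φ)
    (hstat : IsStationary Φ P) (hint : intensity Φ P ≠ ∞) (hcube : MeasurableSet (unitCube d)) :
    ∃ c : ℝ≥0∞, c ≠ ∞ ∧ ∀ (x : Space d) (R : ℝ), 0 ≤ R →
      ∫⁻ ω, Φ ω (Metric.closedBall x R) ∂P = c * ENNReal.ofReal (R ^ d) := by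
  have := isAddLeftInvariant_bind hΦ hstat
  have hfin : P.bind Φ (unitCube d) ≠ ∞ := by
    rwa [Measure.bind_apply hcube hΦ.aemeasurable]
  -- Finitely many translates of the interior of the cube cover a compact set, so finite mass of the
  -- cube suffices.
  have : IsFiniteMeasureOnCompacts (P.bind Φ) := ⟨fun K hK =>
    measure_lt_top_of_isCompact_of_isAddLeftInvariant' (interior_unitCube_nonempty d) hfin hK⟩
  have hHaar := Measure.isAddLeftInvariant_eq_smul (P.bind Φ) (volume : Measure (Space d))
  refine ⟨(Measure.addHaarScalarFactor (P.bind Φ) (volume : Measure (Space d)) : ℝ≥0∞) *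
    volume (Metric.ball (0 : Space d) 1), ?_, fun x R hR => ?_⟩
  · exact ENNReal.mul_ne_top ENNReal.coe_ne_top measure_ball_lt_top.ne
  · rw [← Measure.bind_apply Metric.isClosed_closedBall.measurableSet hΦ.aemeasurable]
    conv_lhs => rw [hHaar]
    rw [Measure.smul_apply, Measure.addHaar_closedBall _ _ hR, finrank_euclideanSpace_fin,
      ENNReal.smul_def, smul_eq_mul, mul_assoc, mul_comm (volume _)]

/-! ### Covering the window and the union bound -/

theorem measurableSet_coordinate_Icc {d : ℕ} (a b : ℝ) :
    MeasurableSet {x : Space d | ∀ i, x i ∈ Set.Icc a b} := by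
  have : {x : Space d | ∀ i, x i ∈ Set.Icc a b} =
      ⋂ i, (fun x : Space d => x i) ⁻¹' Set.Icc a b := by
    ext x; simp
  rw [this]
  exact MeasurableSet.iInter fun i =>
    (isClosed_Icc.preimage (f := fun x : Space d => x i) (by fun_prop)).measurableSet

/-- The point of the lattice `r ℤ^d` with index `z`. -/
noncomputable def latticePoint {d : ℕ} (r : ℝ) (z : Fin d → ℤ) : Space d :=
  WithLp.toLp 2 fun i => r * z i

/-- Each coordinate moves by at most `r`, giving distance at most `√d r`; the cruder `d r` avoids
the root. -/
theorem dist_latticePoint_floor_le {d : ℕ} {r : ℝ} (hr : 0 < r) (x : Space d) :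
    dist x (latticePoint r fun i => ⌊x i / r⌋) ≤ d * r := by
  rw [EuclideanSpace.dist_eq, Real.sqrt_le_iff]
  refine ⟨by positivity, ?_⟩
  have hi (i : Fin d) : dist (x i) (latticePoint r (fun i => ⌊x i / r⌋) i) ^ 2 ≤ r ^ 2 := by
    have h1 : x i = r * (x i / r) := by field_simp
    have h2 := Int.floor_le (x i / r)
    have h3 := Int.lt_floor_add_one (x i / r)
    have h4 : dist (x i) (latticePoint r (fun i => ⌊x i / r⌋) i) ≤ r := by
      change dist (x i) (r * (⌊x i / r⌋ : ℝ)) ≤ r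
      rw [Real.dist_eq, abs_le]
      constructor <;> nlinarith
    exact pow_le_pow_left₀ dist_nonneg h4 2
  calc ∑ i, dist (x i) (latticePoint r (fun i => ⌊x i / r⌋) i) ^ 2
      ≤ ∑ _i : Fin d, r ^ 2 := Finset.sum_le_sum fun i _ => hi i
    _ = d * r ^ 2 := by simp
    _ ≤ (d * r) ^ 2 := by
      rw [mul_pow]
      refine mul_le_mul_of_nonneg_right ?_ (sq_nonneg r)
      exact_mod_cast Nat.le_self_pow two_ne_zero d

/-- With `L = n^{1/d}` and `N = ⌈L / (2r)⌉`, indices in `[-N, N]^d` suffice. The constant `4` comes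
from `2N + 1 < L/r + 3 ≤ 4L/r`, as `r ≤ 1 ≤ L`. -/
theorem exists_finset_cover_window {d n : ℕ} (hd : 1 ≤ d) (hn : 1 ≤ n) {r : ℝ} (hr : 0 < r)
    (hr1 : r ≤ 1) : ∃ Z : Finset (Fin d → ℤ), ((Z.card : ℝ) ≤ 4 ^ d * n / r ^ d) ∧
      ∀ x ∈ window d n, ∃ z ∈ Z, dist x (latticePoint r z) ≤ d * r := by
  set L : ℝ := (n : ℝ) ^ (1 / (d : ℝ)) with hL
  have hL1 : 1 ≤ L := Real.one_le_rpow (by exact_mod_cast hn) (by positivity)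
  have hLd : L ^ d = n := by
    rw [hL, ← Real.rpow_natCast, ← Real.rpow_mul (by positivity),
      one_div_mul_cancel (by positivity), Real.rpow_one]
  set N : ℤ := ⌈L / 2 / r⌉ with hN
  have hN0 : 0 ≤ N := Int.ceil_nonneg (by positivity)
  refine ⟨Fintype.piFinset fun _ => Finset.Icc (-N) N, ?_, fun x hx => ?_⟩
  · have hcard : ((Finset.Icc (-N) N).card : ℝ) = 2 * N + 1 := by
      rw [Int.card_Icc]
      have h1 : (((N + 1 - -N).toNat : ℤ) : ℝ) = ((N + 1 - -N : ℤ) : ℝ) := by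
        rw [Int.toNat_of_nonneg (by omega)]
      rw [Int.cast_natCast] at h1
      rw [h1]
      push_cast
      ring
    rw [Fintype.card_piFinset, Finset.prod_const, Finset.card_univ, Fintype.card_fin, Nat.cast_pow,
      hcard, ← hLd, ← mul_pow, ← div_pow]
    refine pow_le_pow_left₀ (by positivity) ?_ d
    have h1 : (N : ℝ) < L / 2 / r + 1 := Int.ceil_lt_add_one _
    have h2 : 1 ≤ L / r := (one_le_div hr).2 (hr1.trans hL1)
    have h3 : L / 2 / r = L / r / 2 := by ring
    have h4 : 4 * L / r = 4 * (L / r) := by ring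
    rw [h4]
    linarith
  · refine ⟨fun i => ⌊x i / r⌋, ?_, dist_latticePoint_floor_le hr x⟩
    rw [Fintype.mem_piFinset]
    intro i
    obtain ⟨h1, h2⟩ := hx i
    rw [Finset.mem_Icc]
    constructor
    · rw [hN, ← Int.floor_neg]
      refine Int.floor_le_floor ?_
      rw [← neg_div]
      exact div_le_div_of_nonneg_right h1 hr.le
    · rw [hN]
      exact (Int.floor_le_ceil _).trans (Int.ceil_le_ceil (div_le_div_of_nonneg_right h2 hr.le))

theorem isBounded_window {d n : ℕ} (hd : 1 ≤ d) : Bornology.IsBounded (window d n) := by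
  rcases Nat.eq_zero_or_pos n with rfl | hn
  · refine Bornology.isBounded_singleton (x := (0 : Space d)) |>.subset fun x hx => ?_
    rw [Set.mem_singleton_iff]
    ext i
    have h := hx i
    rw [Nat.cast_zero, Real.zero_rpow (by positivity)] at h
    simpa [le_antisymm_iff, and_comm] using h
  · obtain ⟨Z, -, hZ⟩ := exists_finset_cover_window hd hn one_pos le_rfl
    refine ((Bornology.isBounded_biUnion_finset Z).2 fun z _ =>
      Metric.isBounded_closedBall (x := latticePoint 1 z) (r := d * 1)).subset fun x hx => ?_
    obtain ⟨z, hz, hxz⟩ := hZ x hx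
    exact Set.mem_biUnion hz hxz

/-- Some closed ball of radius `r` centred in the window contains `k` distinct atoms. -/
def HasCluster {d : ℕ} (μ : Measure (Space d)) (k n : ℕ) (r : ℝ) : Prop :=
  ∃ x ∈ window d n, HasDistinctAtoms μ k (Metric.closedBall x r)

theorem exists_measure_hasCluster_le {d : ℕ} (hd : 1 ≤ d) {Ω : Type*} [MeasurableSpace Ω]
    {P : Measure Ω} {Φ : Ω → Measure (Space d)} (hΦ : IsPointProcess Φ)
    (hstat : IsStationary Φ P) (hint : intensity Φ P ≠ ∞)
    (hsub : IsAlphaWeaklySubPoisson Φ P) {k : ℕ} (hk : 1 ≤ k) :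
    ∃ C : ℝ≥0∞, C ≠ ∞ ∧ ∀ (n : ℕ) (r : ℝ), 1 ≤ n → 0 < r → r ≤ 1 →
      P {ω | HasCluster (Φ ω) k n r} ≤ C * ENNReal.ofReal (n * r ^ (d * (k - 1))) := by
  obtain ⟨c, hc, hball⟩ := exists_lintegral_closedBall_eq hΦ.measurable hstat hint
    (measurableSet_coordinate_Icc 0 1)
  refine ⟨c ^ k * ENNReal.ofReal (4 ^ d * (d + 1) ^ (d * k)),
    ENNReal.mul_ne_top (ENNReal.pow_ne_top hc) ENNReal.ofReal_ne_top, fun n r hn hr hr1 => ?_⟩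
  obtain ⟨Z, hZcard, hZ⟩ := exists_finset_cover_window hd hn hr hr1
  have hsubset : {ω | HasCluster (Φ ω) k n r} ⊆ ⋃ z ∈ Z,
      {ω | HasDistinctAtoms (Φ ω) k (Metric.closedBall (latticePoint r z) ((d + 1) * r))} := by
    rintro ω ⟨x, hx, p, hp, hpx⟩
    obtain ⟨z, hz, hxz⟩ := hZ x hx
    refine Set.mem_biUnion hz ⟨p, hp, fun i => ⟨(hpx i).1, ?_⟩⟩
    refine Metric.closedBall_subset_closedBall' ?_ (hpx i).2
    linarith
  calc P {ω | HasCluster (Φ ω) k n r}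
      ≤ ∑ z ∈ Z, P {ω | HasDistinctAtoms (Φ ω) k
          (Metric.closedBall (latticePoint r z) ((d + 1) * r))} :=
        (measure_mono hsubset).trans (measure_biUnion_finset_le _ _)
    _ ≤ ∑ _z ∈ Z, (c * ENNReal.ofReal (((d + 1) * r) ^ d)) ^ k := by
        refine Finset.sum_le_sum fun z _ => ?_
        rw [← hball (latticePoint r z) _ (by positivity)]
        exact measure_hasDistinctAtoms_le hΦ hsub hk Metric.isClosed_closedBall.measurableSet
          Metric.isBounded_closedBall
    _ = ENNReal.ofReal Z.card * (c ^ k * ENNReal.ofReal ((((d + 1) * r) ^ d) ^ k)) := by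
        rw [Finset.sum_const, nsmul_eq_mul, ENNReal.ofReal_natCast, mul_pow,
          ← ENNReal.ofReal_pow (by positivity)]
    _ ≤ ENNReal.ofReal (4 ^ d * n / r ^ d) *
          (c ^ k * ENNReal.ofReal ((((d + 1) * r) ^ d) ^ k)) := by gcongr
    _ = c ^ k * ENNReal.ofReal (4 ^ d * (d + 1) ^ (d * k)) *
          ENNReal.ofReal (n * r ^ (d * (k - 1))) := by
        rw [mul_left_comm, mul_assoc, ← ENNReal.ofReal_mul (by positivity),
          ← ENNReal.ofReal_mul (by positivity)]
        congr 2
        -- Writing `k = j + 1` turns `r^{dk} / r^d` into `r^{dj}` without truncated subtraction.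
        obtain ⟨j, rfl⟩ := Nat.exists_eq_add_of_le' hk
        rw [Nat.add_sub_cancel, mul_add_one, ← pow_mul, mul_pow, mul_add_one, pow_add r]
        field_simp

/-! ### From clusters to the graph, and the limits -/

theorem encard_neighborSet_lt {d : ℕ} {μ : Measure (Space d)} {n k : ℕ} (hk : 1 ≤ k) {r : ℝ}
    (hr : 0 ≤ r) (h : ¬ HasCluster μ k n r) (v : (points μ ∩ window d n : Set (Space d))) :
    ((windowGraph μ n r).neighborSet v).encard < ((k - 1 : ℕ) : ℕ∞) := by
  by_contra! hcon
  have := hasDistinctAtoms_of_le_encard_neighborSet hr hcon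
  rw [Nat.sub_add_cancel hk] at this
  exact h ⟨v, v.2.2, this⟩

/-- Subadditivity gives `1 - P(Aᶜ) ≤ P(A)` even for nonmeasurable `A`. -/
theorem withHighProbability_of_compl_subset {Ω : Type*} [MeasurableSpace Ω] {P : Measure Ω}
    [IsProbabilityMeasure P] {A E : ℕ → Set Ω} (hE : Tendsto (fun n => P (E n)) atTop (𝓝 0))
    (hAE : ∀ᶠ n in atTop, (A n)ᶜ ⊆ E n) : WithHighProbability P A := by
  have hcompl : Tendsto (fun n => P (A n)ᶜ) atTop (𝓝 0) :=
    tendsto_of_tendsto_of_tendsto_of_le_of_le' tendsto_const_nhds hE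
      (Eventually.of_forall fun _ => zero_le) (hAE.mono fun n hn => measure_mono hn)
  refine ⟨?_, hcompl⟩
  have hsub : Tendsto (fun n => 1 - P (A n)ᶜ) atTop (𝓝 1) := by
    simpa using ENNReal.Tendsto.sub (tendsto_const_nhds (x := (1 : ℝ≥0∞))) hcompl
      (Or.inl ENNReal.one_ne_top)
  refine tendsto_of_tendsto_of_tendsto_of_le_of_le hsub tendsto_const_nhds (fun n => ?_)
    fun n => prob_le_one
  rw [tsub_le_iff_right, ← measure_univ (μ := P), ← Set.union_compl_self (A n)]
  exact measure_union_le _ _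

theorem tendsto_measure_hasCluster {d : ℕ} (hd : 1 ≤ d) {Ω : Type*} [MeasurableSpace Ω]
    {P : Measure Ω} {Φ : Ω → Measure (Space d)} (hΦ : IsPointProcess Φ)
    (hstat : IsStationary Φ P) (hint : intensity Φ P ≠ ∞)
    (hsub : IsAlphaWeaklySubPoisson Φ P) {k : ℕ} (hk : 1 ≤ k)
    {r : ℕ → ℝ} (hr : ∀ n, 1 ≤ n → 0 < r n)
    (hlim : Tendsto (fun n : ℕ => (n : ℝ) * r n ^ (d * (k - 1))) atTop (𝓝 0)) :
    Tendsto (fun n => P {ω | HasCluster (Φ ω) k n (r n)}) atTop (𝓝 0) := by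
  obtain ⟨C, hC, hbound⟩ := exists_measure_hasCluster_le hd hΦ hstat hint hsub hk
  have hup : Tendsto (fun n : ℕ => C * ENNReal.ofReal (n * r n ^ (d * (k - 1)))) atTop (𝓝 0) := by
    have := ENNReal.Tendsto.const_mul (ENNReal.tendsto_ofReal hlim) (Or.inr hC)
    simpa using this
  refine tendsto_of_tendsto_of_tendsto_of_le_of_le' tendsto_const_nhds hup
    (Eventually.of_forall fun _ => zero_le) ?_
  -- Once `n r_n^{d(k-1)} < 1` with `n ≥ 1`, the radius cannot exceed `1`, so the cluster bound
  -- applies.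
  filter_upwards [hlim.eventually_lt_const one_pos, eventually_ge_atTop 1] with n hn1 hn
  refine hbound n (r n) hn (hr n hn) ?_
  by_contra! hcon
  have h1 : (1 : ℝ) ≤ n := by exact_mod_cast hn
  have h2 : 1 ≤ r n ^ (d * (k - 1)) := one_le_pow₀ hcon.le
  nlinarith

/-- For `k = 1` the hypothesis would say `n → 0`. This excludes the false claim that the maximal
degree is below `0`. -/
theorem two_le_of_tendsto {d k : ℕ} (hk : 1 ≤ k) {r : ℕ → ℝ}
    (hlim : Tendsto (fun n : ℕ => (n : ℝ) * r n ^ (d * (k - 1))) atTop (𝓝 0)) : 2 ≤ k := by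
  by_contra! hcon
  obtain rfl : k = 1 := by omega
  simp only [Nat.sub_self, mul_zero, pow_zero, mul_one] at hlim
  exact not_tendsto_nhds_of_tendsto_atTop tendsto_natCast_atTop_atTop 0 hlim

end SubPoisson

theorem mainTheorem6 {d : ℕ} (hd : 1 ≤ d) {Ω : Type*} [MeasurableSpace Ω]
    (P : Measure Ω) [IsProbabilityMeasure P]
    (Φ : Ω → Measure (SubPoisson.Space d))
    (hΦ : SubPoisson.IsPointProcess Φ)
    (hstat : SubPoisson.IsStationary Φ P)
    (hint : SubPoisson.intensity Φ P = 1)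
    (hsub : SubPoisson.IsAlphaWeaklySubPoisson Φ P)
    (k : ℕ) (hk : 1 ≤ k)
    (r : ℕ → ℝ) (hr : ∀ n, 1 ≤ n → 0 < r n)
    (hlim : Tendsto (fun n : ℕ => (n : ℝ) * r n ^ (d * (k - 1))) atTop (𝓝 0)) :
    SubPoisson.WithHighProbability P
        (fun n => {ω | (SubPoisson.windowGraph (Φ ω) n (r n)).cliqueNum < k}) ∧
      SubPoisson.WithHighProbability P
        (fun n => {ω | SubPoisson.maxDeg (SubPoisson.windowGraph (Φ ω) n (r n))
          < ((k - 1 : ℕ) : ℕ∞)}) ∧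
      SubPoisson.WithHighProbability P
        (fun n => {ω | (SubPoisson.windowGraph (Φ ω) n (r n)).chromaticNumber < (k : ℕ∞)}) := by
  have hk2 := SubPoisson.two_le_of_tendsto hk hlim
  have hE := SubPoisson.tendsto_measure_hasCluster hd hΦ hstat (by simp [hint]) hsub hk hr hlim
  have hdeg {n : ℕ} (hn : 1 ≤ n) {ω : Ω} (hω : ¬ SubPoisson.HasCluster (Φ ω) k n (r n)) :=
    SubPoisson.encard_neighborSet_lt hk (hr n hn).le hω
  refine ⟨SubPoisson.withHighProbability_of_compl_subset hE ?_,
    SubPoisson.withHighProbability_of_compl_subset hE ?_,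
    SubPoisson.withHighProbability_of_compl_subset hE ?_⟩
  all_goals
    filter_upwards [eventually_ge_atTop 1] with n hn ω hω
    by_contra hcon
    refine hω ?_
  · have := SimpleGraph.cliqueNum_le_of_forall_encard_neighborSet_lt _ (hdeg hn hcon)
    exact lt_of_le_of_lt this (by omega)
  · exact SubPoisson.maxDeg_lt (by omega) (hdeg hn hcon)
  · have : Finite (SubPoisson.points (Φ ω) ∩ SubPoisson.window d n :
        Set (SubPoisson.Space d)) :=
      SubPoisson.finite_points_inter (hΦ.counting ω) (SubPoisson.measurableSet_coordinate_Icc _ _)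
        (SubPoisson.isBounded_window hd)
    have hcol :=
      SimpleGraph.colorable_of_forall_encard_neighborSet_lt _ (hdeg hn hcon)
    refine lt_of_le_of_lt hcol.chromaticNumber_le ?_
    exact_mod_cast (by omega : k - 1 < k)
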